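/- Let $\mathbb{D}$ and $\Delta$ be the open and closed unit discs in $\mathbb{C}$, let $\mathcal{G}=\{(z+w,zw): z,w\in\mathbb{D}\}\subset\mathbb{C}^2$ be the open symmetrized bidisc, and put $\Phi(w,s,p)=\dfrac{2wp-s}{2-ws}$. For an open set $U\subset\mathbb{C}$ and a set $E\subset\mathbb{C}^N$ let $\mathrm{Hol}(U,E)$ be the set of holomorphic maps on $U$ with values in $E$; the Schur class is $\mathrm{Hol}(\mathbb{D},\Delta)$. For points $\lambda_1,\dots,\lambda_n\in\mathbb{D}$ and $z_1,\dots,z_n\in E$, the data $\lambda_j\in\mathbb{D}\mapsto z_j\in E$ are called *solvable* if some $h\in\mathrm{Hol}(\mathbb{D},E)$ satisfies $h(\lambda_j)=z_j$ for $j=1,\dots,n$. Solvable data are called - *extremally solvable* if there are no open neighbourhood $U$ of $\Delta$ and $h\in\mathrm{Hol}(U,E)$ with $h(\lambda_j)=z_j$ for all $j$; - *co-extremally solvable* if there are no compact subset $K$ of the interior of $E$ and $h\in\mathrm{Hol}(\mathbb{D},K)$ with $h(\lambda_j)=z_j$ for all $j$; - *barely solvable* if there are no neighbourhoods $V_j\subset\mathbb{D}$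 of $\lambda_j$ such that the data $\lambda_j'\mapsto z_j$ are solvable for all $\lambda_j'\in V_j$, $j=1,\dots,n$; - *co-barely solvable* if there are no neighbourhoods $U_j\subset E$ of $z_j$ in $\mathbb{C}^N$ such that the data $\lambda_j\mapsto z_j'$ are solvable for all $z_j'\in U_j$, $j=1,\dots,n$. Data $\lambda_j\in\mathbb{D}\mapsto z_j\in\mathcal{G}$ *satisfy condition $\mathcal{C}$* if for every Schur function $m$ the data $\lambda_j\in\mathbb{D}\mapsto\Phi(m(\lambda_j),z_j)\in\Delta$, $j=1,\dots,n$, are solvable; they *satisfy condition $\mathcal{C}$ extremally* if, moreover, for some Schur function $m$ these data are extremally solvable. **Theorem.** Let $\lambda_1,\dots,\lambda_n$ be distinct points of $\mathbb{D}$ and let $z_1,\dots,z_n\in\mathcal{G}$. If the interpolation data $\lambda_j\in\mathbb{D}\mapsto z_j\in\mathcal{G}$, $j=1,\dots,n$, are solvable and satisfy condition $\mathcal{C}$ extremally, then they are (1) extremally solvable, (2) co-extremally solvable, (3) barely solvable and (4) co-barely solvable. -/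

import Mathlib

open Set Topology

namespace SymBidisc

section General

variable {V : Type*} [NormedAddCommGroup V] [NormedSpace ℂ V]

/-- `Hol(D, E)`: the maps that are holomorphic on the open set `D` and map `D` into `E`
(only the values on `D` matter). -/
def Hol (D : Set ℂ) (E : Set V) : Set (ℂ → V) :=
  {h | DifferentiableOn ℂ h D ∧ MapsTo h D E}

variable {n : ℕ}

/-- The interpolation data `l j ∈ D ↦ z j ∈ E` are solvable. -/
def Solvable (D : Set ℂ) (E : Set V) (l : Fin n → ℂ) (z : Fin n → V) : Prop :=
  ∃ h ∈ Hol D E, ∀ j, h (l j) = z j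

/-- Solvable, but not by a map into `E` holomorphic on an open neighbourhood of the closure
of `D`. -/
def ExtremallySolvable (D : Set ℂ) (E : Set V) (l : Fin n → ℂ) (z : Fin n → V) : Prop :=
  Solvable D E l z ∧
    ¬ ∃ U : Set ℂ, IsOpen U ∧ closure D ⊆ U ∧ ∃ h ∈ Hol U E, ∀ j, h (l j) = z j

/-- Solvable, but not by a map whose range lies in a compact subset of the interior of `E`. -/
def CoExtremallySolvable (D : Set ℂ) (E : Set V) (l : Fin n → ℂ) (z : Fin n → V) : Prop :=
  Solvable D E l z ∧
    ¬ ∃ K : Set V, IsCompact K ∧ K ⊆ interior E ∧ ∃ h ∈ Hol D K, ∀ j, h (l j) = z j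

/-- The data stay solvable under all small perturbations of the nodes `l j`. -/
def RobustlySolvable (D : Set ℂ) (E : Set V) (l : Fin n → ℂ) (z : Fin n → V) : Prop :=
  ∃ W : Fin n → Set ℂ, (∀ j, W j ∈ 𝓝 (l j) ∧ W j ⊆ D) ∧
    ∀ l' : Fin n → ℂ, (∀ j, l' j ∈ W j) → Solvable D E l' z

/-- Solvable, but not robustly solvable. -/
def BarelySolvable (D : Set ℂ) (E : Set V) (l : Fin n → ℂ) (z : Fin n → V) : Prop :=
  Solvable D E l z ∧ ¬ RobustlySolvable D E l z

/-- The data stay solvable under all small perturbations of the targets `z j`. -/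
def CoRobustlySolvable (D : Set ℂ) (E : Set V) (l : Fin n → ℂ) (z : Fin n → V) : Prop :=
  ∃ W : Fin n → Set V, (∀ j, W j ∈ 𝓝 (z j) ∧ W j ⊆ E) ∧
    ∀ z' : Fin n → V, (∀ j, z' j ∈ W j) → Solvable D E l z'

/-- Solvable, but not co-robustly solvable. -/
def CoBarelySolvable (D : Set ℂ) (E : Set V) (l : Fin n → ℂ) (z : Fin n → V) : Prop :=
  Solvable D E l z ∧ ¬ CoRobustlySolvable D E l z

end General

/-- The open unit disc. -/
def disc : Set ℂ := Metric.ball 0 1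

/-- The closed unit disc. -/
def closedDisc : Set ℂ := Metric.closedBall 0 1

/-- The open symmetrized bidisc `{(z + w, z w) : |z| < 1, |w| < 1}`. -/
def symBidisc : Set (ℂ × ℂ) :=
  {x | ∃ z ∈ disc, ∃ w ∈ disc, x = (z + w, z * w)}

/-- The Schur class: holomorphic maps from the open disc to the closed disc. -/
def Schur : Set (ℂ → ℂ) := Hol disc closedDisc

/-- The function `Φ(w, s, p) = (2 w p - s) / (2 - w s)`; the denominator does not vanish when
`|w| ≤ 1` and `|s| < 2`, in particular for `(s, p)` in the symmetrized bidisc. -/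
noncomputable def Phi (w : ℂ) (x : ℂ × ℂ) : ℂ :=
  (2 * w * x.2 - x.1) / (2 - w * x.1)

/-- Condition `𝒞`: for every Schur function `m`, the Nevanlinna–Pick data
`l j ↦ Φ(m (l j), z j)` are solvable. -/
def ConditionC {n : ℕ} (l : Fin n → ℂ) (z : Fin n → ℂ × ℂ) : Prop :=
  ∀ m ∈ Schur, Solvable disc closedDisc l (fun j => Phi (m (l j)) (z j))

/-- Condition `𝒞` holds, and for some Schur function `m` the Nevanlinna–Pick data
`l j ↦ Φ(m (l j), z j)` are extremally solvable. -/
def ConditionCExtremally {n : ℕ} (l : Fin n → ℂ) (z : Fin n → ℂ × ℂ) : Prop :=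
  ConditionC l z ∧
    ∃ m ∈ Schur, ExtremallySolvable disc closedDisc l (fun j => Phi (m (l j)) (z j))

end SymBidisc

namespace SymBidisc

/-! Everything reduces to excluding a solution `h` with range in a compact subset of the symmetrized
bidisc. Since `|Φ| < 1` there even for `|w| = 1`, compactness gives `|Φ(m, h)| ≤ c < 1` on the disc
for every Schur `m`. This slack pays for dilating `Φ(m, h)` and repairing its values at the nodes,
so the scalar data are never extremally solvable (`exists_hol_nhds_closedDisc`). The other
conclusions follow because a solution near the closed disc, or for suitably perturbed nodes or
targets, yields such an `h`. -/

theorem closure_disc : closure disc = closedDisc :=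
  closure_ball 0 one_ne_zero

/-- The defect identity behind `|Φ| < 1` on the symmetrized bidisc. -/
theorem norm_sq_sub_norm_sq_Phi (w a b : ℂ) :
    ‖2 - w * (a + b)‖ ^ 2 - ‖2 * w * (a * b) - (a + b)‖ ^ 2 =
      2 * (1 - ‖a‖ ^ 2) * ‖1 - w * b‖ ^ 2 + 2 * (1 - ‖b‖ ^ 2) * ‖1 - w * a‖ ^ 2 +
        (1 - ‖w‖ ^ 2) * ‖a - b‖ ^ 2 := by
  simp only [← Complex.normSq_eq_norm_sq, Complex.normSq_apply, Complex.sub_re, Complex.sub_im,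
    Complex.add_re, Complex.add_im, Complex.mul_re, Complex.mul_im, Complex.one_re,
    Complex.one_im, Complex.re_ofNat, Complex.im_ofNat]
  ring

/-- In the defect identity the first two terms are strictly positive and only the third can vanish
when `|w| = 1`, so strictness survives on the boundary. -/
theorem norm_num_lt_norm_den {w : ℂ} (hw : w ∈ closedDisc) {x : ℂ × ℂ} (hx : x ∈ symBidisc) :
    ‖2 * w * x.2 - x.1‖ < ‖2 - w * x.1‖ := by
  obtain ⟨a, ha, b, hb, rfl⟩ := hx
  simp only [disc, closedDisc, Metric.mem_ball, Metric.mem_closedBall, dist_zero_right]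
    at ha hb hw
  have pos : ∀ y : ℂ, ‖y‖ < 1 → 0 < ‖1 - w * y‖ := by
    intro y hy
    rw [norm_pos_iff, sub_ne_zero]
    intro h
    have : ‖w * y‖ = 1 := by rw [← h, norm_one]
    rw [norm_mul] at this
    nlinarith [norm_nonneg y]
  have hA : 0 < 1 - ‖a‖ ^ 2 := by nlinarith [norm_nonneg a]
  have hB : 0 < 1 - ‖b‖ ^ 2 := by nlinarith [norm_nonneg b]
  have hW : 0 ≤ 1 - ‖w‖ ^ 2 := by nlinarith [norm_nonneg w]
  have h1 := pos a ha
  have h2 := pos b hb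
  have key := norm_sq_sub_norm_sq_Phi w a b
  have : 0 < ‖2 - w * (a + b)‖ ^ 2 - ‖2 * w * (a * b) - (a + b)‖ ^ 2 := by
    rw [key]; positivity
  exact lt_of_pow_lt_pow_left₀ 2 (norm_nonneg _) (by linarith)

theorem Phi_den_ne_zero {w : ℂ} (hw : w ∈ closedDisc) {x : ℂ × ℂ} (hx : x ∈ symBidisc) :
    2 - w * x.1 ≠ 0 :=
  norm_pos_iff.1 ((norm_nonneg _).trans_lt (norm_num_lt_norm_den hw hx))

theorem norm_Phi_lt_one {w : ℂ} (hw : w ∈ closedDisc) {x : ℂ × ℂ} (hx : x ∈ symBidisc) :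
    ‖Phi w x‖ < 1 := by
  rw [Phi, norm_div, div_lt_one (norm_pos_iff.2 (Phi_den_ne_zero hw hx))]
  exact norm_num_lt_norm_den hw hx

/-- `Φ` is bounded away from modulus one over compact subsets of the symmetrized bidisc. -/
theorem exists_norm_Phi_le {K : Set (ℂ × ℂ)} (hK : IsCompact K) (hKG : K ⊆ symBidisc) :
    ∃ c < 1, ∀ w ∈ closedDisc, ∀ x ∈ K, ‖Phi w x‖ ≤ c := by
  rcases K.eq_empty_or_nonempty with rfl | hne
  · exact ⟨0, one_pos, by simp⟩
  have hcont : ContinuousOn (fun y : ℂ × (ℂ × ℂ) => ‖Phi y.1 y.2‖) (closedDisc ×ˢ K) := by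
    unfold Phi
    refine ContinuousOn.norm (ContinuousOn.div (by fun_prop) (by fun_prop) ?_)
    rintro ⟨w, x⟩ ⟨hw, hx⟩
    exact Phi_den_ne_zero hw (hKG hx)
  have hdisc : closedDisc.Nonempty := ⟨0, by simp [closedDisc]⟩
  obtain ⟨y, ⟨hy1, hy2⟩, hmax⟩ :=
    ((isCompact_closedBall (0 : ℂ) 1).prod hK).exists_isMaxOn (hdisc.prod hne) hcont
  exact ⟨_, norm_Phi_lt_one hy1 (hKG hy2), fun w hw x hx => hmax (a := (w, x)) ⟨hw, hx⟩⟩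

theorem differentiableOn_Phi_comp {m : ℂ → ℂ} (hm : m ∈ Schur) {h : ℂ → ℂ × ℂ}
    (hh : h ∈ Hol disc symBidisc) : DifferentiableOn ℂ (fun x => Phi (m x) (h x)) disc := by
  have hm' := hm.1
  have h1 := hh.1.fst
  have h2 := hh.1.snd
  unfold Phi
  exact DifferentiableOn.div (by fun_prop) (by fun_prop)
    fun x hx => Phi_den_ne_zero (hm.2 hx) (hh.2 hx)

/-- The values of a function on the disc of supremum norm less than one are also attained by
a function bounded by one on a neighbourhood of the closed disc: dilate, then correct by a small
interpolation polynomial. -/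
theorem exists_hol_nhds_closedDisc {n : ℕ} {l : Fin n → ℂ} (hl : ∀ j, l j ∈ disc)
    (hinj : Function.Injective l) {f : ℂ → ℂ} (hf : DifferentiableOn ℂ f disc) {c : ℝ}
    (hc : c < 1) (hfc : ∀ x ∈ disc, ‖f x‖ ≤ c) :
    ∃ U : Set ℂ, IsOpen U ∧ closure disc ⊆ U ∧ ∃ g ∈ Hol U closedDisc, ∀ j, g (l j) = f (l j) := by
  set L : Fin n → Polynomial ℂ := fun j => Lagrange.basis Finset.univ l j with hL
  have hbound : ∀ j, ∃ M : ℝ, ∀ x ∈ Metric.closedBall (0 : ℂ) 2, ‖(L j).eval x‖ ≤ M := fun j =>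
    (isCompact_closedBall (0 : ℂ) 2).exists_bound_of_continuousOn (L j).continuous.continuousOn
  choose M hM using hbound
  -- This sum bounds the correcting polynomial on the disc of radius 2; it must fit into the slack
  -- `1 - c`.
  have hlim : Filter.Tendsto (fun r : ℝ => ∑ j, ‖f (l j) - f (r * l j)‖ * M j) (𝓝[<] 1) (𝓝 0) := by
    have : ContinuousAt (fun r : ℝ => ∑ j, ‖f (l j) - f (r * l j)‖ * M j) 1 := by
      refine tendsto_finsetSum _ fun j _ => ?_
      have hfj : ContinuousAt f (((1 : ℝ) : ℂ) * l j) := by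
        rw [Complex.ofReal_one, one_mul]
        exact (hf.differentiableAt (Metric.isOpen_ball.mem_nhds (hl j))).continuousAt
      have hcomp : ContinuousAt (fun r : ℝ => f (r * l j)) 1 :=
        ContinuousAt.comp (f := fun r : ℝ => (r : ℂ) * l j) hfj (by fun_prop)
      exact ((continuousAt_const.sub hcomp).norm.mul continuousAt_const)
    simpa [ContinuousAt] using this.tendsto.mono_left nhdsWithin_le_nhds
  have hev : ∀ᶠ r : ℝ in 𝓝[<] 1, ∑ j, ‖f (l j) - f (r * l j)‖ * M j < 1 - c :=
    hlim.eventually_lt_const (by linarith)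
  obtain ⟨r, hr, hr0, hr1⟩ :=
    (hev.and (Ioo_mem_nhdsLT (zero_lt_one' ℝ))).exists
  have hmaps : MapsTo (fun x : ℂ => (r : ℂ) * x) {x | ‖(r : ℂ) * x‖ < 1} disc := fun x hx => by
    simpa [disc] using hx
  refine ⟨{x | ‖(r : ℂ) * x‖ < 1} ∩ Metric.ball 0 2, ?_, ?_,
    fun x => f (r * x) + ∑ j, (f (l j) - f (r * l j)) * (L j).eval x, ⟨?_, ?_⟩, ?_⟩
  · exact (isOpen_lt (by fun_prop) continuous_const).inter Metric.isOpen_ball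
  · intro x hx
    rw [closure_disc, closedDisc, mem_closedBall_zero_iff] at hx
    refine ⟨?_, mem_ball_zero_iff.2 (by linarith)⟩
    rw [mem_ofPred_eq, norm_mul, Complex.norm_of_nonneg hr0.le]
    nlinarith [norm_nonneg x]
  · refine DifferentiableOn.add
      ((hf.comp (by fun_prop) hmaps).mono inter_subset_left) ?_
    exact DifferentiableOn.fun_sum fun j _ =>
      (differentiableOn_const _).mul (L j).differentiable.differentiableOn
  · rintro x ⟨hx1, hx2⟩
    have hsum : ‖∑ j, (f (l j) - f (r * l j)) * (L j).eval x‖ ≤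
        ∑ j, ‖f (l j) - f (r * l j)‖ * M j := by
      refine norm_sum_le_of_le _ fun j _ => ?_
      rw [norm_mul]
      gcongr
      exact hM j x (Metric.ball_subset_closedBall hx2)
    rw [closedDisc, mem_closedBall_zero_iff]
    have := hfc _ (hmaps hx1)
    exact (norm_add_le _ _).trans (by linarith)
  · intro k
    beta_reduce
    rw [Finset.sum_eq_single k]
    · rw [hL, Lagrange.eval_basis_self hinj.injOn (Finset.mem_univ k)]
      ring
    · intro j _ hjk
      rw [hL, Lagrange.eval_basis_of_ne hjk (Finset.mem_univ k), mul_zero]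
    · simp

/-- Data satisfying condition `𝒞` extremally have no solution with range in a compact subset
of the symmetrized bidisc. -/
theorem ConditionCExtremally.not_exists_hol_compact {n : ℕ} {l : Fin n → ℂ}
    {z : Fin n → ℂ × ℂ} (hl : ∀ j, l j ∈ disc) (hinj : Function.Injective l)
    (hC : ConditionCExtremally l z) {K : Set (ℂ × ℂ)} (hK : IsCompact K) (hKG : K ⊆ symBidisc) :
    ¬ ∃ h ∈ Hol disc K, ∀ j, h (l j) = z j := by
  rintro ⟨h, hh, hlz⟩
  obtain ⟨-, m, hm, -, hext⟩ := hC
  obtain ⟨c, hc, hle⟩ := exists_norm_Phi_le hK hKG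
  obtain ⟨U, hU, hDU, g, hg, hgl⟩ := exists_hol_nhds_closedDisc hl hinj
    (differentiableOn_Phi_comp hm ⟨hh.1, hh.2.mono_right hKG⟩) hc
    fun x hx => hle _ (hm.2 hx) _ (hh.2 hx)
  exact hext ⟨U, hU, hDU, g, hg, fun j => by rw [hgl j, hlz j]⟩

theorem ConditionCExtremally.not_exists_hol_nhds {n : ℕ} {l : Fin n → ℂ}
    {z : Fin n → ℂ × ℂ} (hl : ∀ j, l j ∈ disc) (hinj : Function.Injective l)
    (hC : ConditionCExtremally l z) :
    ¬ ∃ U : Set ℂ, IsOpen U ∧ closure disc ⊆ U ∧ ∃ h ∈ Hol U symBidisc, ∀ j, h (l j) = z j := by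
  rintro ⟨U, -, hDU, h, hh, hlz⟩
  rw [closure_disc] at hDU
  refine hC.not_exists_hol_compact hl hinj (K := h '' closedDisc)
    ((isCompact_closedBall (0 : ℂ) 1).image_of_continuousOn (hh.1.continuousOn.mono hDU))
    (hh.2.mono_left hDU).image_subset ⟨h, ⟨?_, ?_⟩, hlz⟩
  · exact hh.1.mono (Metric.ball_subset_closedBall.trans hDU)
  · exact (mapsTo_image h closedDisc).mono_left Metric.ball_subset_closedBall

/-- If `h` solves the data with nodes `r * l j`, then `x ↦ h (r * x)` solves the original data and
is holomorphic on `|x| < 1/r`. -/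
theorem ConditionCExtremally.not_robustlySolvable {n : ℕ} {l : Fin n → ℂ}
    {z : Fin n → ℂ × ℂ} (hl : ∀ j, l j ∈ disc) (hinj : Function.Injective l)
    (hC : ConditionCExtremally l z) : ¬ RobustlySolvable disc symBidisc l z := by
  rintro ⟨W, hW, hsol⟩
  have hev : ∀ᶠ r : ℝ in 𝓝[<] 1, ∀ j, (r : ℂ) * l j ∈ W j := by
    refine Filter.eventually_all.2 fun j => ?_
    have : Filter.Tendsto (fun r : ℝ => (r : ℂ) * l j) (𝓝 1) (𝓝 (((1 : ℝ) : ℂ) * l j)) :=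
      ContinuousAt.tendsto (by fun_prop)
    rw [Complex.ofReal_one, one_mul] at this
    exact (this.mono_left nhdsWithin_le_nhds) (hW j).1
  obtain ⟨r, hr, hr0, hr1⟩ :=
    (hev.and (Ioo_mem_nhdsLT (zero_lt_one' ℝ))).exists
  obtain ⟨h, hh, hlz⟩ := hsol _ hr
  have hmaps : MapsTo (fun x : ℂ => (r : ℂ) * x) {x | ‖(r : ℂ) * x‖ < 1} disc := fun x hx => by
    simpa [disc] using hx
  refine hC.not_exists_hol_nhds hl hinj ⟨{x | ‖(r : ℂ) * x‖ < 1},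
    isOpen_lt (by fun_prop) continuous_const, ?_, fun x => h (r * x),
    ⟨hh.1.comp (by fun_prop) hmaps, hh.2.comp hmaps⟩, hlz⟩
  intro x hx
  rw [closure_disc, closedDisc, mem_closedBall_zero_iff] at hx
  rw [mem_ofPred_eq, norm_mul, Complex.norm_of_nonneg hr0.le]
  nlinarith [norm_nonneg x]

/-- Multiplying both roots `a, b` by `r` acts as `(s, p) ↦ (r s, r² p)`. Targets are expanded by the
inverse map, and a solution is then contracted into a compact set. -/
theorem ConditionCExtremally.not_coRobustlySolvable {n : ℕ} {l : Fin n → ℂ}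
    {z : Fin n → ℂ × ℂ} (hl : ∀ j, l j ∈ disc) (hinj : Function.Injective l)
    (hC : ConditionCExtremally l z) : ¬ CoRobustlySolvable disc symBidisc l z := by
  rintro ⟨W, hW, hsol⟩
  have hev : ∀ᶠ r : ℝ in 𝓝[<] 1,
      ∀ j, ((r : ℂ)⁻¹ * (z j).1, ((r : ℂ)⁻¹) ^ 2 * (z j).2) ∈ W j := by
    refine Filter.eventually_all.2 fun j => ?_
    have : ContinuousAt (fun r : ℝ => ((r : ℂ)⁻¹ * (z j).1, ((r : ℂ)⁻¹) ^ 2 * (z j).2)) 1 := by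
      have : ContinuousAt (fun r : ℝ => (r : ℂ)⁻¹) 1 :=
        ContinuousAt.inv₀ (by fun_prop) (by simp)
      fun_prop
    have := this.tendsto
    simp only [Complex.ofReal_one, inv_one, one_mul, one_pow] at this
    exact (this.mono_left nhdsWithin_le_nhds) (hW j).1
  obtain ⟨r, hr, hr0, hr1⟩ :=
    (hev.and (Ioo_mem_nhdsLT (zero_lt_one' ℝ))).exists
  obtain ⟨h, hh, hlz⟩ := hsol _ hr
  have hrc : (r : ℂ) ≠ 0 := by exact_mod_cast hr0.ne'
  set B : Set ℂ := Metric.closedBall 0 r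
  have hB : B ⊆ disc := Metric.closedBall_subset_ball hr1
  refine hC.not_exists_hol_compact hl hinj
    (K := (fun y : ℂ × ℂ => (y.1 + y.2, y.1 * y.2)) '' (B ×ˢ B)) ?_ ?_
    ⟨fun x => ((r : ℂ) * (h x).1, (r : ℂ) ^ 2 * (h x).2), ⟨?_, ?_⟩, fun j => ?_⟩
  · exact ((isCompact_closedBall 0 r).prod (isCompact_closedBall 0 r)).image (by fun_prop)
  · rintro _ ⟨y, ⟨h1, h2⟩, rfl⟩
    exact ⟨y.1, hB h1, y.2, hB h2, rfl⟩
  · have h1 := hh.1.fst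
    have h2 := hh.1.snd
    exact DifferentiableOn.prodMk (by fun_prop) (by fun_prop)
  · intro x hx
    obtain ⟨a, ha, b, hb, hab⟩ := hh.2 hx
    have scale : ∀ y ∈ disc, (r : ℂ) * y ∈ B := by
      intro y hy
      rw [disc, mem_ball_zero_iff] at hy
      rw [mem_closedBall_zero_iff, norm_mul, Complex.norm_of_nonneg hr0.le]
      nlinarith
    refine ⟨(r * a, r * b), ⟨scale a ha, scale b hb⟩, ?_⟩
    simp only [hab, Prod.mk.injEq]
    constructor <;> ring
  · simp only [hlz j]
    ext <;> field_simp

end SymBidisc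

theorem mainTheorem1 {n : ℕ} (l : Fin n → ℂ) (z : Fin n → ℂ × ℂ)
    (hl : ∀ j, l j ∈ SymBidisc.disc) (hinj : Function.Injective l)
    (hz : ∀ j, z j ∈ SymBidisc.symBidisc)
    (hsolv : SymBidisc.Solvable SymBidisc.disc SymBidisc.symBidisc l z)
    (hC : SymBidisc.ConditionCExtremally l z) :
    SymBidisc.ExtremallySolvable SymBidisc.disc SymBidisc.symBidisc l z ∧
    SymBidisc.CoExtremallySolvable SymBidisc.disc SymBidisc.symBidisc l z ∧
    SymBidisc.BarelySolvable SymBidisc.disc SymBidisc.symBidisc l z ∧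
    SymBidisc.CoBarelySolvable SymBidisc.disc SymBidisc.symBidisc l z := by
  refine ⟨⟨hsolv, hC.not_exists_hol_nhds hl hinj⟩, ⟨hsolv, ?_⟩,
    ⟨hsolv, hC.not_robustlySolvable hl hinj⟩, ⟨hsolv, hC.not_coRobustlySolvable hl hinj⟩⟩
  rintro ⟨K, hK, hKG, hex⟩
  exact hC.not_exists_hol_compact hl hinj hK (hKG.trans interior_subset) hex
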